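/- Consider a Markov decision process with finite state space $S$ and finite nonempty action space $A$, transition probabilities $P_{ij}(u)$ and random one-step costs $g(i,u)$ with $g(i,u)\in[0,1]$ almost surely, and let $\alpha\in(0,1)$ be the discount factor. For a policy $\mu:S\to A$ let $J^\mu(i)=E[\sum_{t\ge 0}\alpha^t g(x_t,\mu(x_t))\mid x_0=i]$, where $(x_t)$ is the state process under $\mu$, and let $J^*(i)=\min_\mu J^\mu(i)$. For $J\in\mathbb{R}^S$ put $(T_\mu J)(i)=E[g(i,\mu(i))]+\alpha\sum_j P_{ij}(\mu(i))J(j)$ and $(TJ)(i)=\min_{u\in A}\big(E[g(i,u)]+\alpha\sum_j P_{ij}(u)J(j)\big)$. Let $H\ge 2$, let $\Phi\in\mathbb{R}^{S\times d}$ be a matrix whose rows are feature vectors of the states, let $D\subseteq S$ be such that the submatrix $\Phi_D$ of the rows indexed by $D$ has rank $d$, and let $\gamma_k\ge 0$ satisfy $\sum_k\gamma_k=\infty$ and $\sum_k\gamma_k^2<\infty$. Starting from $V_0\in\mathbb{R}^S$, for $k=0,1,2,\dots$: (1) choose a policy $\mu_{k+1}$ with $T_{\mu_{k+1}}T^{H-1}V_k=T^HV_k$;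 (2) for $i\in D$ obtain a rollout estimate $\hat J^{\mu_{k+1}}(i)=\sum_{t\ge 0}\alpha^t c_{k,i,t}$, where $c_{k,i,t}$ is the cost incurred at time $t$ of a trajectory simulated under $\mu_{k+1}$ from $i$, so that $c_{k,i,t}\in[0,1]$ almost surely; (3) choose $\theta_{k+1}\in\mathbb{R}^d$ minimizing $\sum_{i\in D}\big((\Phi\theta)(i)-\hat J^{\mu_{k+1}}(i)\big)^2$ over $\theta$; (4) set $V_{k+1}=(1-\gamma_k)V_k+\gamma_k\Phi\theta_{k+1}$. Let $w_k(i)=\hat J^{\mu_{k+1}}(i)-J^{\mu_{k+1}}(i)$ for $i\in D$ and $w_k(i)=0$ for $i\notin D$. Assume that there is a filtration $(\mathcal{F}_k)$ such that, for all $k$, $\mu_{k+1}$ is $\mathcal{F}_k$-measurable, $w_k$ is $\mathcal{F}_{k+1}$-measurable, and $E[w_k\mid\mathcal{F}_k]=0$ (for instance, $\mathcal F_k$ generated by $w_0,\dots,w_{k-1}$). No further condition is imposed on the simulation; the bounds on the costs give $\|w_k\|_\infty\le\frac{1}{1-\alpha}$ almost surely. Let $\mathcal{M}=\Phi(\Phi_D^\top\Phi_D)^{-1}\Phi_D^\top\mathcal{P}$,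 where $\mathcal{P}\in\{0,1\}^{D\times S}$ restricts a vector to its coordinates in $D$, and let $\delta_2=\sup_\mu\|\mathcal{M}J^\mu-J^\mu\|_\infty$, the supremum being over all policies $\mu:S\to A$. Then, with probability 1, $$\limsup_{k\to\infty}\|V_k-J^*\|_\infty\le\frac{\delta_2}{1-\alpha^{H-1}}+\frac{\alpha^{H-1}(1+\alpha)\big(\delta_2+\frac{1}{1-\alpha}\big)}{(1-\alpha)(1-\alpha^{H-1})}.$$ -/

import Mathlib

open MeasureTheory ProbabilityTheory Filter

/-- A finite Markov decision process with state space `S` and action space `A`. In state `i`, the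
action `u` moves the process to state `j` with probability `trans i u j` and incurs a random cost
with law `cost i u`. -/
structure MDP (S A : Type*) where
  trans : S → A → PMF S
  cost : S → A → Measure ℝ
  isProb : ∀ i u, IsProbabilityMeasure (cost i u)

namespace MDP

noncomputable section

variable {S A : Type*}

/-- The costs lie in `[0, 1]` with probability one. -/
def CostsInUnitInterval (m : MDP S A) : Prop :=
  ∀ i u, ∀ᵐ x ∂(m.cost i u), x ∈ Set.Icc (0 : ℝ) 1

/-- Transition probability `P_{ij}(u)` as a real number. -/
def prob (m : MDP S A) (i : S) (u : A) (j : S) : ℝ := (m.trans i u j).toReal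

/-- Expected one-step cost `E[g(i, u)]`. -/
def meanCost (m : MDP S A) (i : S) (u : A) : ℝ := ∫ x, x ∂(m.cost i u)

section Value

variable [Finite S] [MeasurableSpace S] [DiscreteMeasurableSpace S]

/-- The state `i` together with a random cost incurred there under the policy `pol`. -/
def emitKernel (m : MDP S A) (pol : S → A) : Kernel S (S × ℝ) :=
  Kernel.ofFunOfCountable fun i => (Measure.dirac i).prod (m.cost i (pol i))

/-- The Markov kernel of the state process under the policy `pol`. -/
def moveKernel (m : MDP S A) (pol : S → A) : Kernel S S :=
  Kernel.ofFunOfCountable fun i => (m.trans i (pol i)).toMeasure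

/-- The next (state, cost) pair, given all the pairs up to time `n`: it depends only on the state
at time `n`. -/
def stepKernel (m : MDP S A) (pol : S → A) (n : ℕ) :
    Kernel ((_k : Finset.Iic n) → S × ℝ) (S × ℝ) :=
  (m.emitKernel pol ∘ₖ m.moveKernel pol).comap
    (fun h => (h ⟨n, Finset.mem_Iic.2 le_rfl⟩).1) (by fun_prop)

instance (m : MDP S A) (pol : S → A) : IsMarkovKernel (m.emitKernel pol) :=
  ⟨fun i => by
    have := m.isProb i (pol i)
    change IsProbabilityMeasure ((Measure.dirac i).prod (m.cost i (pol i)))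
    infer_instance⟩

instance (m : MDP S A) (pol : S → A) : IsMarkovKernel (m.moveKernel pol) :=
  ⟨fun i => by
    change IsProbabilityMeasure (m.trans i (pol i)).toMeasure
    infer_instance⟩

instance (m : MDP S A) (pol : S → A) (n : ℕ) : IsMarkovKernel (m.stepKernel pol n) := by
  unfold stepKernel
  infer_instance

/-- The law of the whole trajectory `((x_t, g(x_t, pol x_t)))_t` of states and incurred costs under
the policy `pol`, started in state `i`. -/
def trajLaw (m : MDP S A) (pol : S → A) (i : S) : Measure (ℕ → S × ℝ) :=
  Kernel.trajMeasure (X := fun _ => S × ℝ) (m.emitKernel pol i) (m.stepKernel pol)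

/-- The value function `J^pol (i) = E[∑_t α^t g(x_t, pol (x_t)) | x_0 = i]`. -/
def value (m : MDP S A) (α : ℝ) (pol : S → A) (i : S) : ℝ :=
  ∫ τ, ∑' t : ℕ, α ^ t * (τ t).2 ∂(m.trajLaw pol i)

/-- The optimal value function `J^*(i) = min_pol J^pol (i)`. -/
def optValue (m : MDP S A) (α : ℝ) (i : S) : ℝ := ⨅ pol : S → A, m.value α pol i

end Value

variable [Fintype S]

/-- The operator `T_pol J = g_pol + α P_pol J`. -/
def bellmanPol (m : MDP S A) (α : ℝ) (pol : S → A) (J : S → ℝ) (i : S) : ℝ :=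
  m.meanCost i (pol i) + α * ∑ j, m.prob i (pol i) j * J j

/-- The Bellman operator `(T J)(i) = min_u (E[g(i, u)] + α ∑_j P_{ij}(u) J(j))`. -/
def bellman (m : MDP S A) (α : ℝ) (J : S → ℝ) (i : S) : ℝ :=
  ⨅ u : A, (m.meanCost i u + α * ∑ j, m.prob i u j * J j)

/-- `pol` is an `H`-step lookahead policy for `J`: `T_pol T^(H-1) J = T^H J`. -/
def IsLookahead (m : MDP S A) (α : ℝ) (H : ℕ) (J : S → ℝ) (pol : S → A) : Prop :=
  m.bellmanPol α pol ((m.bellman α)^[H - 1] J) = (m.bellman α)^[H] J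

end

end MDP

noncomputable section

/-- The rows of the feature matrix `Φ` that belong to the states of `D`. -/
def featOn {S : Type*} {d : ℕ} (Φ : Matrix S (Fin d) ℝ) (D : Finset S) : Matrix D (Fin d) ℝ :=
  Φ.submatrix (fun i : D => (i : S)) id

/-- The zero-one matrix that restricts a vector on `S` to the coordinates in `D`. -/
def selectOn {S : Type*} [DecidableEq S] (D : Finset S) : Matrix D S ℝ :=
  (1 : Matrix S S ℝ).submatrix (fun i : D => (i : S)) id

/-- The least-squares operator `M = Φ (Φ_Dᵀ Φ_D)⁻¹ Φ_Dᵀ P`. -/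
def lsOperator {S : Type*} [DecidableEq S] {d : ℕ} (Φ : Matrix S (Fin d) ℝ)
    (D : Finset S) : Matrix S S ℝ :=
  Φ * ((featOn Φ D).transpose * featOn Φ D)⁻¹ * (featOn Φ D).transpose * selectOn D

/-- The projection error `δ₂ = sup_pol ‖M J^pol - J^pol‖_∞` over all policies. -/
def projError {S A : Type*} [Fintype S] [DecidableEq S] [MeasurableSpace S]
    [DiscreteMeasurableSpace S] (m : MDP S A) (α : ℝ) {d : ℕ} (Φ : Matrix S (Fin d) ℝ)
    (D : Finset S) : ℝ :=
  ⨆ pol : S → A, ‖(lsOperator Φ D).mulVec (m.value α pol) - m.value α pol‖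

/-- The noise `w` of the estimates `Jhat` of the value function of `pol` at the states in `D`;
it is set to zero at the other states. -/
def rolloutNoise {S A : Type*} [Fintype S] [DecidableEq S] [MeasurableSpace S]
    [DiscreteMeasurableSpace S] (m : MDP S A) (α : ℝ) (D : Finset S)
    (pol : S → A) (Jhat : S → ℝ) (i : S) : ℝ :=
  if i ∈ D then Jhat i - m.value α pol i else 0

/-- One run of least-squares approximate policy iteration with `H`-step lookahead: from `V k`
a lookahead policy `pol (k + 1)` is computed, the weights `θ (k + 1)` are a least-squares fit to the
estimates `Jhat (k + 1) i`, `i ∈ D`, and `V k` is moved towards `Φ θ (k + 1)` with step size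
`γ k`. (`pol 0`, `Jhat 0` and `θ 0` play no role.) -/
structure IsLSRun {S A : Type*} [Fintype S] (m : MDP S A) (α : ℝ) (H : ℕ) {d : ℕ}
    (Φ : Matrix S (Fin d) ℝ) (D : Finset S) (γ : ℕ → ℝ) (V₀ : S → ℝ)
    (pol : ℕ → S → A) (Jhat : ℕ → S → ℝ) (θ : ℕ → Fin d → ℝ) (V : ℕ → S → ℝ) : Prop where
  init : V 0 = V₀
  lookahead : ∀ k, m.IsLookahead α H (V k) (pol (k + 1))
  fit : ∀ k (η : Fin d → ℝ),
    ∑ i ∈ D, (Φ.mulVec (θ (k + 1)) i - Jhat (k + 1) i) ^ 2 ≤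
      ∑ i ∈ D, (Φ.mulVec η i - Jhat (k + 1) i) ^ 2
  update : ∀ k, V (k + 1) = (1 - γ k) • V k + γ k • Φ.mulVec (θ (k + 1))

end

/-!
Write `M` for the least-squares operator, `J*` for the optimal value function, `δ` for the
projection error and `a = α ^ (H - 1)`. Since `Φ_D` has full rank, the normal equations turn the
fitted vector into `M J^pol + M w`, so that `V (k + 1)` averages `V k` with
`M J^pol + M w` (`IsLSRun.update_eq`).

*Noise.* The series `∑ γ k * w k` is a martingale bounded in `L²`, because the noise is bounded and
the step sizes are square summable; hence it converges almost surely
(`ae_exists_tendsto_sum_martingaleDiff`). As the step sizes have infinite sum, averaging the noise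
then leaves a null sequence (`tendsto_zero_of_relaxation`). What remains is a deterministic relaxed
recursion, whose limsup is at most that of its inputs (`eventually_le_of_relaxation`). So the limsup
`e` of `‖V k - J*‖` is at most the limsup of `‖M J^pol - J*‖ ≤ δ + ‖J^pol - J*‖`
(`IsLSRun.isAsympBound`).

*Inputs.* Value functions lie in `[0, 1 / (1 - α)]`, which gives `e ≤ C := δ + 1 / (1 - α)`. On the
other hand `T` and `T_pol` are `α`-contractions with fixed points `J*` and `J^pol`, whence for a
lookahead policy `‖J^pol - J*‖ ≤ (a (1 + α) / (1 - α) + a) ‖V - J*‖`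
(`MDP.IsLookahead.norm_value_sub_optValue_le`). Using `C` for the first summand and `e` for the
second one obtains `e ≤ δ + a (1 + α) / (1 - α) * C + a * e`; solving for `e` gives the bound.

That `J^pol`, which is defined by the law of the trajectory, is a fixed point of `T_pol` follows
from the one-dimensional marginals of that law (`MDP.map_eval_trajLaw`), which identify `J^pol` with
the Neumann series `∑ α ^ t * P_pol ^ t g_pol` (`MDP.hasSum_value`).
-/

/-! ### Relaxed recursions with divergent step sizes -/

section Relaxation

open scoped Topology

/-- A sequence that is repeatedly averaged with inputs whose limsup is at most `B`, with step sizes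
of infinite sum, has itself limsup at most `B`. The excess over `B + ε / 2` is multiplied by
`1 - γ k ≤ exp (-γ k)` in each step. -/
theorem eventually_le_of_relaxation {x b γ : ℕ → ℝ} {B : ℝ}
    (hγ0 : ∀ k, 0 ≤ γ k) (hγle : ∀ᶠ k in atTop, γ k ≤ 1)
    (hdiv : Tendsto (fun n => ∑ k ∈ Finset.range n, γ k) atTop atTop)
    (hx : ∀ᶠ k in atTop, x (k + 1) ≤ (1 - γ k) * x k + γ k * b k)
    (hb : ∀ ε > 0, ∀ᶠ k in atTop, b k ≤ B + ε) :
    ∀ ε > 0, ∀ᶠ k in atTop, x k ≤ B + ε := by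
  intro ε hε
  obtain ⟨N, hN⟩ := eventually_atTop.1 ((hγle.and hx).and (hb (ε / 2) (half_pos hε)))
  set S : ℕ → ℝ := fun n => ∑ k ∈ Finset.range n, γ k with hS
  set y : ℕ → ℝ := fun k => max (x k - (B + ε / 2)) 0 with hy
  have hy0 : ∀ k, 0 ≤ y k := fun k => le_max_right _ _
  have hstep : ∀ k ≥ N, y (k + 1) ≤ Real.exp (-γ k) * y k := by
    intro k hk
    obtain ⟨⟨h1, h2⟩, h3⟩ := hN k hk
    have hle : x k - (B + ε / 2) ≤ y k := le_max_left _ _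
    have hy' : y (k + 1) ≤ (1 - γ k) * y k := by
      refine max_le ?_ (mul_nonneg (by linarith) (hy0 k))
      nlinarith [mul_le_mul_of_nonneg_left h3 (hγ0 k),
        mul_le_mul_of_nonneg_left hle (sub_nonneg.2 h1)]
    refine hy'.trans (mul_le_mul_of_nonneg_right ?_ (hy0 k))
    linarith [Real.add_one_le_exp (-γ k)]
  have hbound : ∀ k ≥ N, y k ≤ Real.exp (-S k) * (Real.exp (S N) * y N) := by
    intro k hk
    induction k, hk using Nat.le_induction with
    | base =>
      rw [← mul_assoc, ← Real.exp_add]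
      simp
    | succ k hk ih =>
      refine (hstep k hk).trans ((mul_le_mul_of_nonneg_left ih (Real.exp_pos _).le).trans_eq ?_)
      rw [← mul_assoc, ← Real.exp_add]
      congr 2
      simp only [hS, Finset.sum_range_succ]
      ring
  have hlim : Tendsto (fun k => Real.exp (-S k) * (Real.exp (S N) * y N)) atTop (𝓝 0) := by
    simpa using (Real.tendsto_exp_neg_atTop_nhds_zero.comp hdiv).mul_const (Real.exp (S N) * y N)
  filter_upwards [hlim.eventually_lt_const (half_pos hε), eventually_ge_atTop N] with k h1 h2
  have h3 : x k - (B + ε / 2) ≤ y k := le_max_left _ _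
  linarith [hbound k h2]

/-- Averaging the inputs `u k` gives a null sequence as soon as the series `∑ γ k * u k` converges:
the difference to the partial sums `R k` of that series satisfies a relaxed recursion with inputs
`-R k`. -/
theorem tendsto_zero_of_relaxation {z u γ : ℕ → ℝ} {l : ℝ}
    (hγ0 : ∀ k, 0 ≤ γ k) (hγle : ∀ᶠ k in atTop, γ k ≤ 1)
    (hdiv : Tendsto (fun n => ∑ k ∈ Finset.range n, γ k) atTop atTop)
    (hz : ∀ k, z (k + 1) = (1 - γ k) * z k + γ k * u k)
    (hu : Tendsto (fun n => ∑ k ∈ Finset.range n, γ k * u k) atTop (𝓝 l)) :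
    Tendsto z atTop (𝓝 0) := by
  set R : ℕ → ℝ := fun n => ∑ k ∈ Finset.range n, γ k * u k with hR
  have hRs : ∀ k, R (k + 1) = R k + γ k * u k := fun k => Finset.sum_range_succ _ _
  have key := eventually_le_of_relaxation (x := fun k => |z k - R k + l|)
    (b := fun k => |R k - l|) (B := 0) hγ0 hγle hdiv ?_ ?_
  · have h1 : Tendsto (fun k => z k - R k + l) atTop (𝓝 0) := by
      rw [Metric.tendsto_atTop']
      intro ε hε
      obtain ⟨N, hN⟩ := eventually_atTop.1 (key (ε / 2) (half_pos hε))
      refine ⟨N, fun n hn => ?_⟩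
      rw [Real.dist_eq, sub_zero]
      linarith [hN n hn.le]
    have h2 := h1.add (hu.sub_const l)
    simp only [sub_self, add_zero] at h2
    refine h2.congr fun k => ?_
    ring
  · filter_upwards [hγle] with k hk
    have : z (k + 1) - R (k + 1) + l = (1 - γ k) * (z k - R k + l) + γ k * (l - R k) := by
      rw [hz, hRs]; ring
    rw [this]
    refine (abs_add_le _ _).trans ?_
    rw [abs_mul, abs_mul, abs_of_nonneg (hγ0 k), abs_of_nonneg (sub_nonneg.2 hk), abs_sub_comm l]
  · intro ε hε
    have := (hu.sub_const l).abs
    simp only [sub_self, abs_zero] at this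
    filter_upwards [this.eventually_lt_const hε] with k hk
    linarith

end Relaxation

/-! ### Almost sure convergence of weighted martingale difference series -/

section MartingaleSeries

variable {Ω : Type*} {mΩ : MeasurableSpace Ω} {P : Measure Ω}
  {F : Filtration ℕ mΩ} {ξ : ℕ → Ω → ℝ} {C : ℝ} {γ : ℕ → ℝ}

theorem ae_abs_sum_range_le (hC : ∀ k, ∀ᵐ ω ∂P, |ξ k ω| ≤ C) (n : ℕ) :
    ∀ᵐ ω ∂P, |∑ k ∈ Finset.range n, γ k * ξ k ω| ≤ ∑ k ∈ Finset.range n, |γ k| * C := by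
  filter_upwards [ae_all_iff.2 hC] with ω hω
  refine (Finset.abs_sum_le_sum_abs _ _).trans (Finset.sum_le_sum fun k _ => ?_)
  rw [abs_mul]
  exact mul_le_mul_of_nonneg_left (hω k) (abs_nonneg _)

theorem measurable_sum_range_of_adapted (hξ : ∀ k, Measurable[F (k + 1)] (ξ k)) (n : ℕ) :
    Measurable[F n] (fun ω => ∑ k ∈ Finset.range n, γ k * ξ k ω) := by
  refine Finset.measurable_fun_sum _ fun k hk => ?_
  exact ((hξ k).mono (F.mono (Finset.mem_range.1 hk)) le_rfl).const_mul _

variable [IsProbabilityMeasure P]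

theorem integrable_of_ae_abs_le {f : Ω → ℝ} (hf : Measurable f) {K : ℝ}
    (hK : ∀ᵐ ω ∂P, |f ω| ≤ K) : Integrable f P :=
  Integrable.of_bound hf.aestronglyMeasurable K hK

theorem integral_mul_eq_zero_of_condExp_eq_zero {m : MeasurableSpace Ω} (hm : m ≤ mΩ)
    {f g : Ω → ℝ} (hf : Measurable[m] f) (hg : Integrable g P)
    (hfg : Integrable (fun ω => f ω * g ω) P) (h0 : P[g | m] =ᵐ[P] 0) :
    ∫ ω, f ω * g ω ∂P = 0 := by
  have h1 : P[f * g | m] =ᵐ[P] f * P[g | m] :=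
    condExp_mul_of_stronglyMeasurable_left hf.stronglyMeasurable hfg hg
  rw [← integral_condExp hm]
  have h2 : P[fun ω => f ω * g ω | m] =ᵐ[P] 0 := by
    refine h1.trans ?_
    filter_upwards [h0] with ω hω
    simp [hω]
  rw [integral_congr_ae h2]
  simp

/-- Orthogonality of martingale differences: the second moment of the partial sums is at most the
sum of the second moments. -/
theorem integral_sum_range_sq_le (hξ : ∀ k, Measurable[F (k + 1)] (ξ k))
    (hC : ∀ k, ∀ᵐ ω ∂P, |ξ k ω| ≤ C) (h0 : ∀ k, P[ξ k | F k] =ᵐ[P] 0) (n : ℕ) :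
    ∫ ω, (∑ k ∈ Finset.range n, γ k * ξ k ω) ^ 2 ∂P ≤
      C ^ 2 * ∑ k ∈ Finset.range n, γ k ^ 2 := by
  induction n with
  | zero => simp
  | succ n ih =>
    set N : Ω → ℝ := fun ω => ∑ k ∈ Finset.range n, γ k * ξ k ω with hN
    set K := ∑ k ∈ Finset.range n, |γ k| * C
    have hNF : Measurable[F n] N := measurable_sum_range_of_adapted hξ n
    have hNm : Measurable N := hNF.mono (F.le n) le_rfl
    have hξm : Measurable (ξ n) := (hξ n).mono (F.le _) le_rfl
    have hNb : ∀ᵐ ω ∂P, |N ω| ≤ K := ae_abs_sum_range_le hC n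
    have hNξ : Integrable (fun ω => N ω * ξ n ω) P := by
      refine integrable_of_ae_abs_le (K := K * C) (hNm.mul hξm) ?_
      filter_upwards [hNb, hC n] with ω h1 h2
      rw [abs_mul]
      exact mul_le_mul h1 h2 (abs_nonneg _) ((abs_nonneg _).trans h1)
    have hN2 : Integrable (fun ω => N ω ^ 2) P := by
      refine integrable_of_ae_abs_le (K := K ^ 2) (hNm.pow_const 2) ?_
      filter_upwards [hNb] with ω h1
      rw [abs_pow]
      exact pow_le_pow_left₀ (abs_nonneg _) h1 2
    have hξ2b : ∀ᵐ ω ∂P, |ξ n ω ^ 2| ≤ C ^ 2 := by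
      filter_upwards [hC n] with ω h1
      rw [abs_pow]
      exact pow_le_pow_left₀ (abs_nonneg _) h1 2
    have hξ2 : Integrable (fun ω => ξ n ω ^ 2) P :=
      integrable_of_ae_abs_le (hξm.pow_const 2) hξ2b
    have horth : ∫ ω, N ω * ξ n ω ∂P = 0 :=
      integral_mul_eq_zero_of_condExp_eq_zero (F.le n) hNF
        (integrable_of_ae_abs_le hξm (hC n)) hNξ (h0 n)
    have hvar : ∫ ω, ξ n ω ^ 2 ∂P ≤ C ^ 2 := by
      calc ∫ ω, ξ n ω ^ 2 ∂P ≤ ∫ _, C ^ 2 ∂P := by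
            refine integral_mono_ae hξ2 (integrable_const _) ?_
            filter_upwards [hξ2b] with ω h1
            exact (le_abs_self _).trans h1
        _ = C ^ 2 := by simp
    have hexp : ∀ ω, (∑ k ∈ Finset.range (n + 1), γ k * ξ k ω) ^ 2 =
        (N ω ^ 2 + 2 * γ n * (N ω * ξ n ω)) + γ n ^ 2 * ξ n ω ^ 2 := by
      intro ω
      rw [Finset.sum_range_succ]
      simp only [hN]
      ring
    simp_rw [hexp]
    have hmid : Integrable (fun ω => N ω ^ 2 + 2 * γ n * (N ω * ξ n ω)) P :=
      hN2.add (hNξ.const_mul _)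
    rw [integral_add hmid (hξ2.const_mul _), integral_add hN2 (hNξ.const_mul _),
      integral_const_mul, integral_const_mul, horth, Finset.sum_range_succ]
    nlinarith [mul_le_mul_of_nonneg_left hvar (sq_nonneg (γ n))]

/-- The series of bounded martingale differences with square summable weights converges almost
surely: its partial sums form a martingale bounded in `L²`, hence in `L¹`. -/
theorem ae_exists_tendsto_sum_martingaleDiff (hξ : ∀ k, Measurable[F (k + 1)] (ξ k))
    (hC : ∀ k, ∀ᵐ ω ∂P, |ξ k ω| ≤ C) (h0 : ∀ k, P[ξ k | F k] =ᵐ[P] 0)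
    (hγ : Summable fun k => γ k ^ 2) :
    ∀ᵐ ω ∂P, ∃ l, Tendsto (fun n => ∑ k ∈ Finset.range n, γ k * ξ k ω) atTop (nhds l) := by
  set N : ℕ → Ω → ℝ := fun n ω => ∑ k ∈ Finset.range n, γ k * ξ k ω with hN
  have hNF : ∀ n, Measurable[F n] (N n) := measurable_sum_range_of_adapted hξ
  have hNm : ∀ n, Measurable (N n) := fun n => (hNF n).mono (F.le n) le_rfl
  have hNi : ∀ n, Integrable (N n) P := fun n =>
    integrable_of_ae_abs_le (hNm n) (ae_abs_sum_range_le hC n)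
  have hmart : Martingale N F P := by
    refine martingale_nat (fun n => (hNF n).stronglyMeasurable) hNi fun n => ?_
    have hξi : Integrable (ξ n) P :=
      integrable_of_ae_abs_le ((hξ n).mono (F.le _) le_rfl) (hC n)
    have hs : N (n + 1) = N n + γ n • ξ n := by
      ext ω
      simp [hN, Finset.sum_range_succ]
    rw [hs]
    have h1 := condExp_add (hNi n) (hξi.smul (γ n)) (F n)
    have h2 := condExp_smul (γ n) (ξ n) (F n) (μ := P)
    have h3 := condExp_of_stronglyMeasurable (F.le n) (hNF n).stronglyMeasurable (hNi n)
    filter_upwards [h1, h2, h0 n] with ω e1 e2 e3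
    rw [e1, Pi.add_apply, e2, h3, Pi.smul_apply, e3]
    simp
  set K : ℝ := C ^ 2 * ∑' k, γ k ^ 2
  have hsq : ∀ n, ∫ ω, N n ω ^ 2 ∂P ≤ K := fun n =>
    (integral_sum_range_sq_le hξ hC h0 n).trans
      (mul_le_mul_of_nonneg_left (hγ.sum_le_tsum _ fun _ _ => sq_nonneg _) (sq_nonneg _))
  have hL1 : ∀ n, eLpNorm (N n) 1 P ≤ ((1 + K).toNNReal : ENNReal) := by
    intro n
    have hN2 : Integrable (fun ω => N n ω ^ 2) P := by
      refine integrable_of_ae_abs_le (K := (∑ k ∈ Finset.range n, |γ k| * C) ^ 2)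
        ((hNm n).pow_const 2) ?_
      filter_upwards [ae_abs_sum_range_le hC n] with ω h1
      rw [abs_pow]
      exact pow_le_pow_left₀ (abs_nonneg _) h1 2
    rw [eLpNorm_one_eq_lintegral_enorm, ← ofReal_integral_norm_eq_lintegral_enorm (hNi n)]
    refine ENNReal.ofReal_le_ofReal ?_
    calc ∫ ω, ‖N n ω‖ ∂P ≤ ∫ ω, (1 + N n ω ^ 2) ∂P := by
          refine integral_mono (hNi n).norm ((integrable_const _).add hN2) fun ω => ?_
          simp only [Real.norm_eq_abs]
          nlinarith [sq_nonneg (|N n ω| - 1), sq_abs (N n ω)]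
      _ ≤ 1 + K := by
          rw [integral_add (integrable_const _) hN2]
          simpa using hsq n
  exact hmart.submartingale.exists_ae_tendsto_of_bdd hL1

end MartingaleSeries

/-! ### The Bellman operators -/

namespace MDP

section Operators

variable {S A : Type*}

theorem prob_nonneg (m : MDP S A) (i : S) (u : A) (j : S) : 0 ≤ m.prob i u j :=
  ENNReal.toReal_nonneg

theorem sum_prob [Fintype S] (m : MDP S A) (i : S) (u : A) : ∑ j, m.prob i u j = 1 := by
  unfold prob
  rw [← ENNReal.toReal_sum fun j _ => (m.trans i u).apply_ne_top j,
    ← tsum_fintype (L := .unconditional S), (m.trans i u).tsum_coe, ENNReal.toReal_one]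

theorem meanCost_mem_Icc (m : MDP S A) (hcost : m.CostsInUnitInterval) (i : S) (u : A) :
    m.meanCost i u ∈ Set.Icc (0 : ℝ) 1 := by
  have := m.isProb i u
  have hi : Integrable (fun x : ℝ => x) (m.cost i u) := by
    refine Integrable.of_bound measurable_id.aestronglyMeasurable 1 ?_
    filter_upwards [hcost i u] with x hx
    rw [Real.norm_eq_abs, abs_of_nonneg hx.1]
    exact hx.2
  constructor
  · exact integral_nonneg_of_ae ((hcost i u).mono fun x hx => hx.1)
  · have h := integral_mono_ae hi (integrable_const (1 : ℝ)) ((hcost i u).mono fun x hx => hx.2)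
    simpa [meanCost] using h

variable [Fintype S]

theorem sum_prob_mul_le (m : MDP S A) (i : S) (u : A) {f g : S → ℝ} {c : ℝ}
    (h : ∀ j, f j ≤ g j + c) :
    ∑ j, m.prob i u j * f j ≤ ∑ j, m.prob i u j * g j + c := by
  calc ∑ j, m.prob i u j * f j ≤ ∑ j, m.prob i u j * (g j + c) :=
        Finset.sum_le_sum fun j _ => mul_le_mul_of_nonneg_left (h j) (m.prob_nonneg i u j)
    _ = ∑ j, m.prob i u j * g j + c := by
        simp_rw [mul_add]
        rw [Finset.sum_add_distrib, ← Finset.sum_mul, m.sum_prob, one_mul]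

theorem le_add_norm_sub (f g : S → ℝ) (j : S) : f j ≤ g j + ‖f - g‖ := by
  have := norm_le_pi_norm (f - g) j
  rw [Pi.sub_apply, Real.norm_eq_abs] at this
  linarith [le_abs_self (f j - g j)]

/-- The expression minimized in the Bellman operator, in the form that gives both monotonicity
(`c = 0`) and contractivity (`c = ‖f - g‖`). -/
theorem qValue_le (m : MDP S A) {α : ℝ} (hα0 : 0 ≤ α) (i : S) (u : A) {f g : S → ℝ} {c : ℝ}
    (h : ∀ j, f j ≤ g j + c) :
    m.meanCost i u + α * ∑ j, m.prob i u j * f j ≤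
      (m.meanCost i u + α * ∑ j, m.prob i u j * g j) + α * c := by
  have := mul_le_mul_of_nonneg_left (m.sum_prob_mul_le i u h) hα0
  linarith

theorem norm_bellmanPol_sub_le (m : MDP S A) {α : ℝ} (hα0 : 0 ≤ α) (pol : S → A) (f g : S → ℝ) :
    ‖m.bellmanPol α pol f - m.bellmanPol α pol g‖ ≤ α * ‖f - g‖ := by
  refine (pi_norm_le_iff_of_nonneg (mul_nonneg hα0 (norm_nonneg _))).2 fun i => ?_
  have h1 := m.qValue_le hα0 i (pol i) (le_add_norm_sub f g)
  have h2 := m.qValue_le hα0 i (pol i) (le_add_norm_sub g f)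
  rw [norm_sub_rev g f] at h2
  rw [Pi.sub_apply, Real.norm_eq_abs, abs_le]
  unfold bellmanPol
  constructor <;> linarith

variable [Finite A]

theorem bellman_le (m : MDP S A) (α : ℝ) (f : S → ℝ) (i : S) (u : A) :
    m.bellman α f i ≤ m.meanCost i u + α * ∑ j, m.prob i u j * f j :=
  ciInf_le (Set.finite_range _).bddBelow u

theorem bellman_le_bellmanPol (m : MDP S A) (α : ℝ) (pol : S → A) (f : S → ℝ) :
    m.bellman α f ≤ m.bellmanPol α pol f :=
  fun i => m.bellman_le α f i (pol i)

variable [Nonempty A]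

theorem bellman_apply_le (m : MDP S A) {α : ℝ} (hα0 : 0 ≤ α) {f g : S → ℝ} {c : ℝ}
    (h : ∀ j, f j ≤ g j + c) (i : S) : m.bellman α f i ≤ m.bellman α g i + α * c := by
  rw [← sub_le_iff_le_add]
  refine le_ciInf fun u => ?_
  linarith [m.bellman_le α f i u, m.qValue_le hα0 i u h]

theorem norm_bellman_sub_le (m : MDP S A) {α : ℝ} (hα0 : 0 ≤ α) (f g : S → ℝ) :
    ‖m.bellman α f - m.bellman α g‖ ≤ α * ‖f - g‖ := by
  refine (pi_norm_le_iff_of_nonneg (mul_nonneg hα0 (norm_nonneg _))).2 fun i => ?_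
  have h1 := m.bellman_apply_le hα0 (le_add_norm_sub f g) i
  have h2 := m.bellman_apply_le hα0 (le_add_norm_sub g f) i
  rw [norm_sub_rev g f] at h2
  rw [Pi.sub_apply, Real.norm_eq_abs, abs_le]
  constructor <;> linarith

theorem norm_iterate_bellman_sub_le (m : MDP S A) {α : ℝ} (hα0 : 0 ≤ α) (n : ℕ) (f g : S → ℝ) :
    ‖(m.bellman α)^[n] f - (m.bellman α)^[n] g‖ ≤ α ^ n * ‖f - g‖ := by
  induction n with
  | zero => simp
  | succ n ih =>
    rw [Function.iterate_succ_apply', Function.iterate_succ_apply', pow_succ', mul_assoc]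
    exact (m.norm_bellman_sub_le hα0 _ _).trans (mul_le_mul_of_nonneg_left ih hα0)

theorem monotone_bellman (m : MDP S A) {α : ℝ} (hα0 : 0 ≤ α) : Monotone (m.bellman α) :=
  fun f g h i => by
    simpa using m.bellman_apply_le hα0 (c := 0) (fun j => by simpa using h j) i

theorem contractingWith_bellman (m : MDP S A) {α : ℝ} (hα0 : 0 ≤ α) (hα1 : α < 1) :
    ContractingWith ⟨α, hα0⟩ (m.bellman α) := by
  refine ⟨by exact_mod_cast hα1, LipschitzWith.of_dist_le_mul fun f g => ?_⟩
  rw [dist_eq_norm, dist_eq_norm]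
  exact m.norm_bellman_sub_le hα0 f g

theorem exists_bellmanPol_eq_bellman (m : MDP S A) (α : ℝ) (f : S → ℝ) :
    ∃ pol, m.bellmanPol α pol f = m.bellman α f := by
  choose pol hpol using fun i =>
    exists_eq_ciInf_of_finite (f := fun u => m.meanCost i u + α * ∑ j, m.prob i u j * f j)
  exact ⟨pol, funext hpol⟩

end Operators

/-! ### The value function of a policy solves its Bellman equation -/

section Trajectories

variable {S A : Type*} [Finite S] [MeasurableSpace S] [DiscreteMeasurableSpace S]

/-- The law of the state at time `t` under the policy `pol`, started in state `i`. -/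
noncomputable def stateLaw (m : MDP S A) (pol : S → A) (i : S) : ℕ → Measure S
  | 0 => Measure.dirac i
  | t + 1 => m.moveKernel pol ∘ₘ stateLaw m pol i t

instance (m : MDP S A) (pol : S → A) (i : S) (t : ℕ) :
    IsProbabilityMeasure (m.stateLaw pol i t) := by
  induction t with
  | zero => unfold stateLaw; infer_instance
  | succ t ih => unfold stateLaw; infer_instance

instance (m : MDP S A) (pol : S → A) (i : S) : IsProbabilityMeasure (m.trajLaw pol i) := by
  unfold trajLaw
  infer_instance

theorem integral_measure_comp {X Y : Type*} [MeasurableSpace X] [MeasurableSpace Y]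
    {κ : Kernel X Y} {μ : Measure X} [IsProbabilityMeasure μ] [IsMarkovKernel κ] {f : Y → ℝ}
    (hf : Integrable f (κ ∘ₘ μ)) : ∫ y, f y ∂(κ ∘ₘ μ) = ∫ x, ∫ y, f y ∂(κ x) ∂μ := by
  rw [Measure.comp_eq_comp_const_apply] at hf ⊢
  rw [Kernel.integral_comp hf, Kernel.const_apply]

theorem map_fst_emitKernel_comp (m : MDP S A) (pol : S → A) (μ : Measure S) :
    (m.emitKernel pol ∘ₘ μ).map Prod.fst = μ := by
  rw [Measure.map_comp _ _ measurable_fst]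
  have : (m.emitKernel pol).map Prod.fst = Kernel.id := by
    ext i : 1
    have := m.isProb i (pol i)
    rw [Kernel.map_apply _ measurable_fst, Kernel.id_apply]
    change ((Measure.dirac i).prod (m.cost i (pol i))).map Prod.fst = _
    rw [Measure.map_fst_prod]
    simp
  rw [this, Measure.id_comp]

/-- At each time, the state is distributed according to `stateLaw`, and given the state the cost is
drawn from its law in that state. -/
theorem map_eval_trajLaw (m : MDP S A) (pol : S → A) (i : S) (t : ℕ) :
    (m.trajLaw pol i).map (fun τ => τ t) = m.emitKernel pol ∘ₘ m.stateLaw pol i t := by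
  induction t with
  | zero =>
    have h0 : m.emitKernel pol ∘ₘ m.stateLaw pol i 0 = m.emitKernel pol i := by
      unfold stateLaw
      exact Measure.dirac_bind (Kernel.measurable _) i
    rw [h0, trajLaw, Kernel.trajMeasure]
    have h1 : (fun τ : ℕ → S × ℝ => τ 0) =
        (fun h : (_k : Finset.Iic 0) → S × ℝ => h ⟨0, Finset.mem_Iic.2 le_rfl⟩) ∘
          Preorder.frestrictLe 0 := rfl
    have h2 : (Kernel.traj (X := fun _ => S × ℝ) (m.stepKernel pol) 0).map
        (Preorder.frestrictLe 0) = Kernel.id :=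
      Kernel.traj_map_frestrictLe_of_le le_rfl
    rw [h1, ← Measure.map_map (by fun_prop) (by fun_prop), Measure.map_comp _ _ (by fun_prop),
      h2, Measure.id_comp]
    exact (Measure.map_map (measurable_pi_apply _) (MeasurableEquiv.measurable _)).trans
      Measure.map_id
  | succ t ih =>
    have h1 := Kernel.map_frestrictLe_trajMeasure_compProd_eq_map_trajMeasure
      (X := fun _ => S × ℝ) (μ₀ := m.emitKernel pol i) (κ := m.stepKernel pol) (a := t)
    have h2 := congrArg (Measure.map Prod.snd) h1
    rw [Measure.map_map measurable_snd (by fun_prop)] at h2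
    have h3 : (m.trajLaw pol i).map (fun τ => τ (t + 1)) =
        m.stepKernel pol t ∘ₘ (m.trajLaw pol i).map (Preorder.frestrictLe t) := by
      rw [← Measure.snd_compProd]
      exact h2.symm
    have h4 : m.stepKernel pol t = (m.emitKernel pol ∘ₖ m.moveKernel pol) ∘ₖ
        Kernel.deterministic (fun h : (_k : Finset.Iic t) → S × ℝ =>
          (h ⟨t, Finset.mem_Iic.2 le_rfl⟩).1) (by fun_prop) := by
      rw [Kernel.comp_deterministic_eq_comap]
      rfl
    have h5 : ((m.trajLaw pol i).map (Preorder.frestrictLe t)).map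
        (fun h : (_k : Finset.Iic t) → S × ℝ => (h ⟨t, Finset.mem_Iic.2 le_rfl⟩).1) =
        m.stateLaw pol i t := by
      rw [Measure.map_map (by fun_prop) (by fun_prop)]
      have := congrArg (Measure.map Prod.fst) ih
      rw [map_fst_emitKernel_comp, Measure.map_map measurable_fst (by fun_prop)] at this
      exact this
    rw [h3, h4, ← Measure.comp_assoc, Measure.deterministic_comp_eq_map, h5, stateLaw,
      Measure.comp_assoc]

theorem ae_cost_mem_Icc (m : MDP S A) (hcost : m.CostsInUnitInterval) (pol : S → A) (i : S)
    (t : ℕ) : ∀ᵐ τ ∂(m.trajLaw pol i), (τ t).2 ∈ Set.Icc (0 : ℝ) 1 := by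
  have h : ∀ᵐ x ∂((m.trajLaw pol i).map (fun τ => τ t)), x.2 ∈ Set.Icc (0 : ℝ) 1 := by
    rw [map_eval_trajLaw]
    refine Measure.ae_comp_of_ae_ae (measurable_snd measurableSet_Icc) (ae_of_all _ fun j => ?_)
    have := m.isProb j (pol j)
    change ∀ᵐ x ∂((Measure.dirac j).prod (m.cost j (pol j))), x.2 ∈ Set.Icc (0 : ℝ) 1
    exact Measure.quasiMeasurePreserving_snd.ae (hcost j (pol j))
  exact ae_of_ae_map (f := fun τ : ℕ → S × ℝ => τ t) (measurable_pi_apply t).aemeasurable h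

theorem integrable_cost (m : MDP S A) (hcost : m.CostsInUnitInterval) (pol : S → A) (i : S)
    (t : ℕ) : Integrable (fun τ : ℕ → S × ℝ => (τ t).2) (m.trajLaw pol i) := by
  refine Integrable.of_bound (by fun_prop : Measurable _).aestronglyMeasurable 1 ?_
  filter_upwards [m.ae_cost_mem_Icc hcost pol i t] with τ h
  rw [Real.norm_eq_abs, abs_of_nonneg h.1]
  exact h.2

theorem integral_cost (m : MDP S A) (hcost : m.CostsInUnitInterval) (pol : S → A) (i : S)
    (t : ℕ) :
    ∫ τ, (τ t).2 ∂(m.trajLaw pol i) = ∫ j, m.meanCost j (pol j) ∂(m.stateLaw pol i t) := by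
  have h1 : ∫ τ, (τ t).2 ∂(m.trajLaw pol i) =
      ∫ x, x.2 ∂((m.trajLaw pol i).map (fun τ => τ t)) :=
    (integral_map (measurable_pi_apply t).aemeasurable
      measurable_snd.aestronglyMeasurable).symm
  have h2 : Integrable (fun x : S × ℝ => x.2) (m.emitKernel pol ∘ₘ m.stateLaw pol i t) := by
    rw [← map_eval_trajLaw, integrable_map_measure measurable_snd.aestronglyMeasurable
      (measurable_pi_apply t).aemeasurable]
    exact m.integrable_cost hcost pol i t
  rw [h1, map_eval_trajLaw, integral_measure_comp h2]
  refine integral_congr_ae (ae_of_all _ fun j => ?_)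
  have := m.isProb j (pol j)
  change ∫ x, x.2 ∂((Measure.dirac j).prod (m.cost j (pol j))) = ∫ x, x ∂(m.cost j (pol j))
  have := integral_fun_snd (μ := Measure.dirac j) (ν := m.cost j (pol j)) (fun x : ℝ => x)
  simpa using this

end Trajectories

section BellmanEquation

variable {S A : Type*} [Fintype S]

/-- The linear part `J ↦ P_pol J` of the Bellman operator of a policy. -/
noncomputable def nextMean (m : MDP S A) (pol : S → A) (f : S → ℝ) (i : S) : ℝ :=
  ∑ j, m.prob i (pol i) j * f j

theorem iterate_nextMean_mem_Icc (m : MDP S A) (pol : S → A) {f : S → ℝ}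
    (hf : ∀ i, f i ∈ Set.Icc (0 : ℝ) 1) (t : ℕ) (i : S) :
    (m.nextMean pol)^[t] f i ∈ Set.Icc (0 : ℝ) 1 := by
  induction t generalizing i with
  | zero => exact hf i
  | succ t ih =>
    rw [Function.iterate_succ_apply']
    refine ⟨Finset.sum_nonneg fun j _ => mul_nonneg (m.prob_nonneg _ _ _) (ih j).1, ?_⟩
    have := m.sum_prob_mul_le i (pol i) (f := (m.nextMean pol)^[t] f) (g := 0) (c := 1)
      (fun j => by simpa using (ih j).2)
    simpa [nextMean] using this

variable [MeasurableSpace S] [DiscreteMeasurableSpace S]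

theorem integral_stateLaw (m : MDP S A) (pol : S → A) (i : S) (t : ℕ) (f : S → ℝ) :
    ∫ j, f j ∂(m.stateLaw pol i t) = (m.nextMean pol)^[t] f i := by
  induction t generalizing f with
  | zero => simp [stateLaw]
  | succ t ih =>
    rw [stateLaw, integral_measure_comp Integrable.of_finite, Function.iterate_succ_apply, ← ih]
    refine integral_congr_ae (ae_of_all _ fun j => ?_)
    change ∫ x, f x ∂(m.trans j (pol j)).toMeasure = _
    rw [PMF.integral_eq_sum]
    rfl

variable {α : ℝ}

/-- The value of a policy as a Neumann series `∑ α^t P_pol^t g_pol`. -/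
theorem hasSum_value (m : MDP S A) (hcost : m.CostsInUnitInterval) (hα0 : 0 ≤ α) (hα1 : α < 1)
    (pol : S → A) (i : S) :
    HasSum (fun t => α ^ t * (m.nextMean pol)^[t] (fun j => m.meanCost j (pol j)) i)
      (m.value α pol i) := by
  have h := hasSum_integral_of_summable_integral_norm (μ := m.trajLaw pol i)
    (F := fun (t : ℕ) (τ : ℕ → S × ℝ) => α ^ t * (τ t).2)
    (fun t => (m.integrable_cost hcost pol i t).const_mul _) ?_
  · simp_rw [integral_const_mul, m.integral_cost hcost, m.integral_stateLaw pol i _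
      (fun j => m.meanCost j (pol j))] at h
    exact h
  · refine (summable_geometric_of_lt_one hα0 hα1).of_nonneg_of_le
      (fun t => integral_nonneg fun _ => norm_nonneg _) fun t => ?_
    have := norm_integral_le_of_norm_le_const (μ := m.trajLaw pol i) (C := α ^ t)
      (f := fun τ : ℕ → S × ℝ => ‖α ^ t * (τ t).2‖) ?_
    · simpa using (le_abs_self _).trans this
    · filter_upwards [m.ae_cost_mem_Icc hcost pol i t] with τ hτ
      rw [norm_norm, norm_mul, Real.norm_eq_abs, Real.norm_eq_abs, abs_of_nonneg (pow_nonneg hα0 t),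
        abs_of_nonneg hτ.1]
      exact mul_le_of_le_one_right (pow_nonneg hα0 t) hτ.2

theorem value_mem_Icc (m : MDP S A) (hcost : m.CostsInUnitInterval) (hα0 : 0 ≤ α) (hα1 : α < 1)
    (pol : S → A) (i : S) : m.value α pol i ∈ Set.Icc 0 (1 / (1 - α)) := by
  have h := m.hasSum_value hcost hα0 hα1 pol i
  have hb := fun t =>
    m.iterate_nextMean_mem_Icc pol (fun j => m.meanCost_mem_Icc hcost j (pol j)) t i
  constructor
  · exact h.nonneg fun t => mul_nonneg (pow_nonneg hα0 t) (hb t).1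
  · rw [one_div]
    exact hasSum_le (fun t => mul_le_of_le_one_right (pow_nonneg hα0 t) (hb t).2) h
      (hasSum_geometric_of_lt_one hα0 hα1)

theorem bellmanPol_value (m : MDP S A) (hcost : m.CostsInUnitInterval) (hα0 : 0 ≤ α)
    (hα1 : α < 1) (pol : S → A) : m.bellmanPol α pol (m.value α pol) = m.value α pol := by
  ext i
  have h := fun i => m.hasSum_value hcost hα0 hα1 pol i
  have h1 : HasSum (fun t => α ^ (t + 1) *
      (m.nextMean pol)^[t + 1] (fun j => m.meanCost j (pol j)) i)
      (α * ∑ j, m.prob i (pol i) j * m.value α pol j) := by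
    have hsum := (hasSum_sum fun j (_ : j ∈ Finset.univ) =>
      (h j).mul_left (m.prob i (pol i) j)).mul_left α
    have heq : ∀ t, α ^ (t + 1) * (m.nextMean pol)^[t + 1] (fun j => m.meanCost j (pol j)) i =
        α * ∑ j, m.prob i (pol i) j *
          (α ^ t * (m.nextMean pol)^[t] (fun j => m.meanCost j (pol j)) j) := by
      intro t
      rw [Function.iterate_succ_apply', nextMean, Finset.mul_sum, Finset.mul_sum]
      exact Finset.sum_congr rfl fun j _ => by ring
    simp_rw [heq]
    exact hsum
  have h2 := (hasSum_nat_add_iff' 1).2 (h i)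
  have h3 := h1.unique h2
  simp only [Finset.range_one, Finset.sum_singleton, pow_zero, Function.iterate_zero, id_eq,
    one_mul] at h3
  rw [bellmanPol, h3]
  ring

end BellmanEquation

/-! ### The optimal value function and lookahead policies -/

section Optimal

variable {S A : Type*} [Fintype S] [MeasurableSpace S] [DiscreteMeasurableSpace S]
  {α : ℝ}

theorem norm_value_sub_le (m : MDP S A) (hcost : m.CostsInUnitInterval) (hα0 : 0 ≤ α)
    (hα1 : α < 1) (pol : S → A) (f : S → ℝ) :
    ‖m.value α pol - f‖ ≤ ‖m.bellmanPol α pol f - f‖ / (1 - α) := by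
  rw [le_div_iff₀ (sub_pos.2 hα1)]
  have h1 := m.norm_bellmanPol_sub_le hα0 pol (m.value α pol) f
  rw [m.bellmanPol_value hcost hα0 hα1] at h1
  have h2 := norm_sub_le_norm_sub_add_norm_sub (m.value α pol) (m.bellmanPol α pol f) f
  linarith

variable [Finite A] [Nonempty A]

theorem bellman_optValue (m : MDP S A) (hcost : m.CostsInUnitInterval) (hα0 : 0 ≤ α)
    (hα1 : α < 1) : m.bellman α (m.optValue α) = m.optValue α := by
  have hc := m.contractingWith_bellman hα0 hα1
  set J := hc.fixedPoint (m.bellman α) with hJ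
  have hfix : m.bellman α J = J := hc.fixedPoint_isFixedPt
  obtain ⟨pol, hpol⟩ := m.exists_bellmanPol_eq_bellman α J
  have hval : m.value α pol = J := by
    have := m.norm_value_sub_le hcost hα0 hα1 pol J
    rw [hpol, hfix, sub_self, norm_zero, zero_div] at this
    exact sub_eq_zero.1 (norm_le_zero_iff.1 this)
  have hle : ∀ pol', J ≤ m.value α pol' := by
    intro pol'
    have h1 : m.bellman α (m.value α pol') ≤ m.value α pol' :=
      (m.bellman_le_bellmanPol α pol' _).trans_eq (m.bellmanPol_value hcost hα0 hα1 pol')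
    have h2 := (m.monotone_bellman hα0).antitone_iterate_of_map_le h1
    exact le_of_tendsto (hc.tendsto_iterate_fixedPoint (m.value α pol'))
      (Eventually.of_forall fun n => h2 (Nat.zero_le n))
  have : m.optValue α = J := by
    ext i
    refine le_antisymm ?_ (le_ciInf fun pol' => hle pol' i)
    rw [← hval]
    exact ciInf_le (Set.finite_range _).bddBelow pol
  rw [this, hfix]

theorem norm_value_sub_optValue_le (m : MDP S A) (hcost : m.CostsInUnitInterval) (hα0 : 0 ≤ α)
    (hα1 : α < 1) (pol : S → A) : ‖m.value α pol - m.optValue α‖ ≤ 1 / (1 - α) := by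
  have h0 : (0 : ℝ) ≤ 1 / (1 - α) := (one_div_pos.2 (sub_pos.2 hα1)).le
  refine (pi_norm_le_iff_of_nonneg h0).2 fun i => ?_
  have h1 := m.value_mem_Icc hcost hα0 hα1 pol i
  have h2 : 0 ≤ m.optValue α i := le_ciInf fun p => (m.value_mem_Icc hcost hα0 hα1 p i).1
  have h3 : m.optValue α i ≤ m.value α pol i := ciInf_le (Set.finite_range _).bddBelow pol
  rw [Pi.sub_apply, Real.norm_eq_abs, abs_of_nonneg (sub_nonneg.2 h3)]
  linarith [h1.2]

/-- Performance of a lookahead policy: its value is close to `T^(H-1) J`, since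
`T_pol T^(H-1) J - T^(H-1) J = T^(H-1) (T J) - T^(H-1) J`, and `T^(H-1) J` is close to the optimal
value function. -/
theorem IsLookahead.norm_value_sub_optValue_le {m : MDP S A} (hcost : m.CostsInUnitInterval)
    (hα0 : 0 ≤ α) (hα1 : α < 1) {H : ℕ} (hH : 1 ≤ H) {J : S → ℝ} {pol : S → A}
    (h : m.IsLookahead α H J pol) :
    ‖m.value α pol - m.optValue α‖ ≤
      α ^ (H - 1) * (1 + α) / (1 - α) * ‖J - m.optValue α‖ +
        α ^ (H - 1) * ‖J - m.optValue α‖ := by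
  set G := (m.bellman α)^[H - 1] J with hG
  have hfix := m.bellman_optValue hcost hα0 hα1
  have h1 : ‖G - m.optValue α‖ ≤ α ^ (H - 1) * ‖J - m.optValue α‖ := by
    have := m.norm_iterate_bellman_sub_le hα0 (H - 1) J (m.optValue α)
    rwa [Function.iterate_fixed hfix] at this
  have h2 : m.bellmanPol α pol G = (m.bellman α)^[H - 1] (m.bellman α J) := by
    rw [← Function.iterate_succ_apply, Nat.succ_eq_add_one, Nat.sub_add_cancel hH]
    exact h
  have h3 : ‖m.bellman α J - J‖ ≤ (1 + α) * ‖J - m.optValue α‖ := by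
    have e1 := m.norm_bellman_sub_le hα0 J (m.optValue α)
    rw [hfix] at e1
    have e2 := norm_sub_le_norm_sub_add_norm_sub (m.bellman α J) (m.optValue α) J
    rw [norm_sub_rev (m.optValue α) J] at e2
    linarith
  have h4 : ‖m.value α pol - G‖ ≤ α ^ (H - 1) * (1 + α) / (1 - α) * ‖J - m.optValue α‖ := by
    refine (m.norm_value_sub_le hcost hα0 hα1 pol G).trans ?_
    rw [div_mul_eq_mul_div]
    refine div_le_div_of_nonneg_right ?_ (sub_pos.2 hα1).le
    rw [h2, mul_assoc]
    exact (m.norm_iterate_bellman_sub_le hα0 _ _ _).trans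
      (mul_le_mul_of_nonneg_left h3 (pow_nonneg hα0 _))
  exact (norm_sub_le_norm_sub_add_norm_sub _ G _).trans (add_le_add h4 h1)

end Optimal

end MDP

/-! ### Least-squares fits -/

section LeastSquares

variable {S : Type*} [Fintype S] [DecidableEq S] {d : ℕ}

/-- The normal equations: the residual of a least-squares fit is orthogonal to all columns. -/
theorem transpose_mulVec_residual_eq_zero {ι κ : Type*} [Fintype ι] [Fintype κ]
    (B : Matrix ι κ ℝ) (y : ι → ℝ) (θ : κ → ℝ)
    (h : ∀ η, ∑ i, (B.mulVec θ i - y i) ^ 2 ≤ ∑ i, (B.mulVec η i - y i) ^ 2) :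
    B.transpose.mulVec (B.mulVec θ - y) = 0 := by
  set r := B.mulVec θ - y with hr
  set g := B.transpose.mulVec r with hg
  set q := ∑ i, (B.mulVec g i) ^ 2 with hq
  have hq0 : 0 ≤ q := Finset.sum_nonneg fun i _ => sq_nonneg _
  have hrg : ∑ i, r i * B.mulVec g i = ∑ j, g j ^ 2 := by
    have h1 : r ⬝ᵥ B.mulVec g = g ⬝ᵥ g := by
      rw [Matrix.dotProduct_mulVec, ← Matrix.mulVec_transpose]
    simpa [dotProduct, sq] using h1
  have key : ∀ t : ℝ, 0 ≤ q * (t * t) + -2 * (∑ j, g j ^ 2) * t + 0 := by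
    intro t
    have h1 := h (θ - t • g)
    have h2 : ∀ i, (B.mulVec (θ - t • g) i - y i) ^ 2 =
        (B.mulVec θ i - y i) ^ 2 + -2 * t * (r i * B.mulVec g i) + t * t * (B.mulVec g i) ^ 2 := by
      intro i
      rw [Matrix.mulVec_sub, Matrix.mulVec_smul]
      simp only [Pi.sub_apply, Pi.smul_apply, smul_eq_mul, hr]
      ring
    simp_rw [h2, Finset.sum_add_distrib, ← Finset.mul_sum, hrg] at h1
    linarith
  -- a quadratic without constant term that is nonnegative has no linear term either
  have hd := discrim_le_zero key
  rw [discrim] at hd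
  have h0 : ∑ j, g j ^ 2 = 0 := by nlinarith [sq_nonneg (∑ j, g j ^ 2)]
  ext j
  have := (Finset.sum_eq_zero_iff_of_nonneg fun j _ => sq_nonneg (g j)).1 h0 j (Finset.mem_univ j)
  simpa using this

theorem selectOn_mulVec (D : Finset S) (f : S → ℝ) (i : D) :
    (selectOn D).mulVec f i = f i := by
  simp [selectOn, Matrix.mulVec, dotProduct, Matrix.one_apply]

theorem isUnit_det_gram {ι : Type*} [Fintype ι] {B : Matrix ι (Fin d) ℝ} (hB : B.rank = d) :
    IsUnit (B.transpose * B).det := by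
  rw [← Matrix.isUnit_iff_isUnit_det, ← Matrix.linearIndependent_cols_iff_isUnit,
    linearIndependent_iff_card_eq_finrank_span, Set.finrank, ← Matrix.rank_eq_finrank_span_cols,
    Matrix.rank_transpose_mul_self, hB, Fintype.card_fin]

/-- The fitted vector is the image of the data under the least-squares operator. -/
theorem mulVec_eq_lsOperator_mulVec (Φ : Matrix S (Fin d) ℝ) (D : Finset S)
    (hrank : (featOn Φ D).rank = d) (y : S → ℝ) (θ : Fin d → ℝ)
    (h : ∀ η : Fin d → ℝ, ∑ i ∈ D, (Φ.mulVec θ i - y i) ^ 2 ≤ ∑ i ∈ D, (Φ.mulVec η i - y i) ^ 2) :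
    Φ.mulVec θ = (lsOperator Φ D).mulVec y := by
  have hfeat : ∀ (η : Fin d → ℝ) (i : D), (featOn Φ D).mulVec η i = Φ.mulVec η i := fun _ _ => rfl
  have hN := transpose_mulVec_residual_eq_zero (featOn Φ D) ((selectOn D).mulVec y) θ fun η => by
    simp_rw [hfeat, selectOn_mulVec]
    rw [Finset.sum_coe_sort D fun i => (Φ.mulVec θ i - y i) ^ 2,
      Finset.sum_coe_sort D fun i => (Φ.mulVec η i - y i) ^ 2]
    exact h η
  rw [Matrix.mulVec_sub, sub_eq_zero, Matrix.mulVec_mulVec] at hN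
  have hθ : θ = ((featOn Φ D).transpose * featOn Φ D)⁻¹.mulVec
      ((featOn Φ D).transpose.mulVec ((selectOn D).mulVec y)) := by
    rw [← hN, Matrix.mulVec_mulVec, Matrix.nonsing_inv_mul _ (isUnit_det_gram hrank),
      Matrix.one_mulVec]
  rw [hθ]
  simp only [lsOperator, Matrix.mulVec_mulVec, Matrix.mul_assoc]

theorem lsOperator_mulVec_congr (Φ : Matrix S (Fin d) ℝ) {D : Finset S} {f g : S → ℝ}
    (h : ∀ i ∈ D, f i = g i) : (lsOperator Φ D).mulVec f = (lsOperator Φ D).mulVec g := by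
  have : (selectOn D).mulVec f = (selectOn D).mulVec g := by
    ext i
    rw [selectOn_mulVec, selectOn_mulVec, h i i.2]
  simp only [lsOperator, ← Matrix.mulVec_mulVec, this]

end LeastSquares

/-! ### Asymptotic error of the iteration for convergent noise series -/

section Asymptotics

open scoped Topology

/-- `c` is an asymptotic upper bound of the real sequence `x`: every number above `c` is an eventual
upper bound. -/
def IsAsympBound (x : ℕ → ℝ) (c : ℝ) : Prop :=
  ∀ ε > 0, ∀ᶠ k in atTop, x k ≤ c + ε

/-- A self-improving asymptotic bound `e ↦ K + a * e` with `a < 1` improves to its fixed point,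
since the least asymptotic bound is attained. -/
theorem IsAsympBound.of_selfImproving {x : ℕ → ℝ} {a K c : ℝ} (ha : a < 1) (hx : ∀ k, 0 ≤ x k)
    (hc : IsAsympBound x c) (himp : ∀ e, IsAsympBound x e → IsAsympBound x (K + a * e)) :
    IsAsympBound x (K / (1 - a)) := by
  have hne : {e | IsAsympBound x e}.Nonempty := ⟨c, hc⟩
  have hbdd : BddBelow {e | IsAsympBound x e} := by
    refine ⟨0, fun e he => le_of_forall_pos_le_add fun ε hε => ?_⟩
    obtain ⟨k, hk⟩ := (he ε hε).exists
    exact (hx k).trans hk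
  set s := sInf {e | IsAsympBound x e} with hs
  have hsmem : IsAsympBound x s := by
    intro ε hε
    obtain ⟨e, he, hlt⟩ := exists_lt_of_csInf_lt hne (lt_add_of_pos_right s (half_pos hε))
    filter_upwards [he (ε / 2) (half_pos hε)] with k hk
    linarith
  have h1 : s ≤ K + a * s := csInf_le hbdd (himp s hsmem)
  have h2 : s ≤ K / (1 - a) := by
    rw [le_div_iff₀ (sub_pos.2 ha)]
    linarith
  intro ε hε
  filter_upwards [hsmem ε hε] with k hk
  linarith

theorem IsAsympBound.limsup_le {x : ℕ → ℝ} {c : ℝ} (h : IsAsympBound x c) :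
    limsup (fun k => ((x k : ℝ) : EReal)) atTop ≤ (c : EReal) := by
  rw [limsup_le_iff]
  intro y hy
  obtain ⟨r, hcr, hry⟩ := EReal.lt_iff_exists_real_btwn.1 hy
  have hcr' : c < r := by exact_mod_cast hcr
  filter_upwards [h (r - c) (sub_pos.2 hcr')] with k hk
  refine lt_of_le_of_lt ?_ hry
  exact_mod_cast (by linarith : x k ≤ r)

theorem tendsto_sum_mulVec {S : Type*} [Fintype S] {γ : ℕ → ℝ} (M : Matrix S S ℝ)
    (w : ℕ → S → ℝ)
    (h : ∀ i, ∃ l, Tendsto (fun n => ∑ k ∈ Finset.range n, γ k * w k i) atTop (𝓝 l)) (i : S) :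
    ∃ l, Tendsto (fun n => ∑ k ∈ Finset.range n, γ k * M.mulVec (w k) i) atTop (𝓝 l) := by
  choose l hl using h
  refine ⟨∑ j, M i j * l j, ?_⟩
  refine (tendsto_finsetSum Finset.univ fun j _ => (hl j).const_mul (M i j)).congr fun n => ?_
  simp_rw [Matrix.mulVec, dotProduct, Finset.mul_sum]
  rw [Finset.sum_comm]
  exact Finset.sum_congr rfl fun k _ => Finset.sum_congr rfl fun j _ => by ring

variable {S A : Type*} [Fintype S] [DecidableEq S] [MeasurableSpace S] [DiscreteMeasurableSpace S]
  {m : MDP S A} {α : ℝ} {H d : ℕ} {Φ : Matrix S (Fin d) ℝ} {D : Finset S} {γ : ℕ → ℝ}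
  {V₀ : S → ℝ} {pol : ℕ → S → A} {Jhat : ℕ → S → ℝ} {θ : ℕ → Fin d → ℝ} {V : ℕ → S → ℝ}

/-- In a run, the iterate is averaged with the projected value function of the current policy,
perturbed by the projected noise. -/
theorem IsLSRun.update_eq (h : IsLSRun m α H Φ D γ V₀ pol Jhat θ V)
    (hrank : (featOn Φ D).rank = d) (k : ℕ) :
    V (k + 1) = (1 - γ k) • V k + γ k • ((lsOperator Φ D).mulVec (m.value α (pol (k + 1))) +
      (lsOperator Φ D).mulVec (rolloutNoise m α D (pol (k + 1)) (Jhat (k + 1)))) := by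
  rw [h.update, mulVec_eq_lsOperator_mulVec Φ D hrank (Jhat (k + 1)) (θ (k + 1)) (h.fit k),
    ← Matrix.mulVec_add]
  congr 2
  refine lsOperator_mulVec_congr Φ fun i hi => ?_
  simp [rolloutNoise, hi]

theorem norm_lsOperator_mulVec_value_sub_le [Finite A] (pol : S → A) :
    ‖(lsOperator Φ D).mulVec (m.value α pol) - m.value α pol‖ ≤ projError m α Φ D :=
  le_ciSup (f := fun pol : S → A =>
    ‖(lsOperator Φ D).mulVec (m.value α pol) - m.value α pol‖) (Set.finite_range _).bddAbove pol

/-- The distance of the iterates to any vector `J` inherits asymptotic bounds from the projected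
value functions: the contribution of the noise is a null sequence. -/
theorem IsLSRun.isAsympBound (h : IsLSRun m α H Φ D γ V₀ pol Jhat θ V)
    (hrank : (featOn Φ D).rank = d) (hγ0 : ∀ k, 0 ≤ γ k) (hγle : ∀ᶠ k in atTop, γ k ≤ 1)
    (hdiv : Tendsto (fun n => ∑ k ∈ Finset.range n, γ k) atTop atTop)
    (hnoise : ∀ i, ∃ l, Tendsto (fun n => ∑ k ∈ Finset.range n,
      γ k * rolloutNoise m α D (pol (k + 1)) (Jhat (k + 1)) i) atTop (𝓝 l))
    (J : S → ℝ) {c : ℝ}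
    (hc : IsAsympBound (fun k => ‖(lsOperator Φ D).mulVec (m.value α (pol (k + 1))) - J‖) c) :
    IsAsympBound (fun k => ‖V k - J‖) c := by
  set M := lsOperator Φ D
  set u : ℕ → S → ℝ := fun k => M.mulVec (rolloutNoise m α D (pol (k + 1)) (Jhat (k + 1)))
  -- the accumulated noise
  let Z : ℕ → S → ℝ := fun n => Nat.rec 0 (fun k z => (1 - γ k) • z + γ k • u k) n
  have hZs : ∀ k, Z (k + 1) = (1 - γ k) • Z k + γ k • u k := fun _ => rfl
  have hZ : Tendsto Z atTop (𝓝 0) := by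
    refine tendsto_pi_nhds.2 fun i => ?_
    obtain ⟨l, hl⟩ := tendsto_sum_mulVec M _ hnoise i
    refine tendsto_zero_of_relaxation (u := fun k => u k i) hγ0 hγle hdiv (fun k => ?_) hl
    rw [hZs]
    rfl
  have hy : IsAsympBound (fun k => ‖V k - Z k - J‖) c := by
    refine eventually_le_of_relaxation hγ0 hγle hdiv ?_ hc
    filter_upwards [hγle] with k hk
    have : V (k + 1) - Z (k + 1) - J = (1 - γ k) • (V k - Z k - J) +
        γ k • (M.mulVec (m.value α (pol (k + 1))) - J) := by
      rw [h.update_eq hrank, hZs]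
      ext i
      simp only [Pi.sub_apply, Pi.add_apply, Pi.smul_apply, smul_eq_mul, u]
      ring
    rw [this]
    refine (norm_add_le _ _).trans_eq ?_
    rw [norm_smul, norm_smul, Real.norm_of_nonneg (sub_nonneg.2 hk), Real.norm_of_nonneg (hγ0 k)]
  intro ε hε
  have hZn : Tendsto (fun k => ‖Z k‖) atTop (𝓝 0) := by simpa using hZ.norm
  filter_upwards [hy (ε / 2) (half_pos hε), hZn.eventually_lt_const (half_pos hε)] with k h1 h2
  have h3 : V k - J = (V k - Z k - J) + Z k := by abel
  have h4 := norm_add_le (V k - Z k - J) (Z k)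
  rw [← h3] at h4
  linarith

/-- The error bound along a single run whose noise series converges. -/
theorem IsLSRun.isAsympBound_optValue [Finite A] [Nonempty A]
    (h : IsLSRun m α H Φ D γ V₀ pol Jhat θ V) (hcost : m.CostsInUnitInterval)
    (hα0 : 0 < α) (hα1 : α < 1) (hH : 2 ≤ H)
    (hrank : (featOn Φ D).rank = d) (hγ0 : ∀ k, 0 ≤ γ k) (hγle : ∀ᶠ k in atTop, γ k ≤ 1)
    (hdiv : Tendsto (fun n => ∑ k ∈ Finset.range n, γ k) atTop atTop)
    (hnoise : ∀ i, ∃ l, Tendsto (fun n => ∑ k ∈ Finset.range n,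
      γ k * rolloutNoise m α D (pol (k + 1)) (Jhat (k + 1)) i) atTop (𝓝 l)) :
    IsAsympBound (fun k => ‖V k - m.optValue α‖)
      (projError m α Φ D / (1 - α ^ (H - 1)) +
        α ^ (H - 1) * ((1 + α) * (projError m α Φ D + 1 / (1 - α))) /
          ((1 - α) * (1 - α ^ (H - 1)))) := by
  set J := m.optValue α
  set δ := projError m α Φ D
  set a := α ^ (H - 1) with ha
  have ha0 : 0 ≤ a := pow_nonneg hα0.le _
  have ha1 : a < 1 := pow_lt_one₀ hα0.le hα1 (by omega)
  have h1α : 0 < 1 - α := sub_pos.2 hα1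
  have h1a : 0 < 1 - a := sub_pos.2 ha1
  set κ := a * (1 + α) / (1 - α) with hκ
  have hκ0 : 0 ≤ κ := by positivity
  set C := δ + 1 / (1 - α)
  have hb : ∀ k, ‖(lsOperator Φ D).mulVec (m.value α (pol (k + 1))) - J‖ ≤
      δ + ‖m.value α (pol (k + 1)) - J‖ := fun k =>
    (norm_sub_le_norm_sub_add_norm_sub _ (m.value α (pol (k + 1))) _).trans
      (add_le_add_left (norm_lsOperator_mulVec_value_sub_le _) _)
  have hC : IsAsympBound (fun k => ‖V k - J‖) C := by
    refine h.isAsympBound hrank hγ0 hγle hdiv hnoise J fun ε hε => Eventually.of_forall fun k => ?_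
    have := m.norm_value_sub_optValue_le hcost hα0.le hα1 (pol (k + 1))
    linarith [hb k]
  have himp : ∀ e, IsAsympBound (fun k => ‖V k - J‖) e →
      IsAsympBound (fun k => ‖V k - J‖) ((δ + κ * C) + a * e) := by
    intro e he
    refine h.isAsympBound hrank hγ0 hγle hdiv hnoise J fun ε hε => ?_
    have hε' : 0 < ε / (κ + 1) / 2 := by positivity
    filter_upwards [hC _ hε', he _ (half_pos hε)] with k h1 h2
    have h3 := (h.lookahead k).norm_value_sub_optValue_le hcost hα0.le hα1 (by omega : 1 ≤ H)
    have h4 : κ * ‖V k - J‖ ≤ κ * C + ε / 2 := by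
      have e1 := mul_le_mul_of_nonneg_left h1 hκ0
      have e2 : κ * (ε / (κ + 1) / 2) ≤ ε / 2 := by
        have : κ * (ε / (κ + 1) / 2) = κ / (κ + 1) * (ε / 2) := by ring
        rw [this]
        refine mul_le_of_le_one_left (half_pos hε).le ((div_le_one (by positivity)).2 (by linarith))
      linarith
    have h5 : a * ‖V k - J‖ ≤ a * e + ε / 2 := by
      have e1 := mul_le_mul_of_nonneg_left h2 ha0
      have e2 : a * (ε / 2) ≤ ε / 2 := mul_le_of_le_one_left (half_pos hε).le ha1.le
      linarith
    linarith [hb k]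
  have hfin := IsAsympBound.of_selfImproving ha1 (fun k => norm_nonneg _) hC himp
  convert hfin using 1
  rw [hκ]
  field_simp

end Asymptotics

/-! ### Boundedness of the rollout noise -/

section Noise

theorem tsum_discounted_mem_Icc {α : ℝ} (hα0 : 0 ≤ α) (hα1 : α < 1) {c : ℕ → ℝ}
    (hc : ∀ t, c t ∈ Set.Icc (0 : ℝ) 1) : ∑' t, α ^ t * c t ∈ Set.Icc 0 (1 / (1 - α)) := by
  have h0 : ∀ t, 0 ≤ α ^ t * c t := fun t => mul_nonneg (pow_nonneg hα0 t) (hc t).1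
  have h1 : ∀ t, α ^ t * c t ≤ α ^ t := fun t => mul_le_of_le_one_right (pow_nonneg hα0 t) (hc t).2
  have hg := summable_geometric_of_lt_one hα0 hα1
  refine ⟨tsum_nonneg h0, ?_⟩
  rw [one_div, ← tsum_geometric_of_lt_one hα0 hα1]
  exact (hg.of_nonneg_of_le h0 h1).tsum_le_tsum h1 hg

theorem abs_rolloutNoise_le {S A : Type*} [Fintype S] [DecidableEq S] [MeasurableSpace S]
    [DiscreteMeasurableSpace S] (m : MDP S A) (hcost : m.CostsInUnitInterval) {α : ℝ}
    (hα0 : 0 ≤ α) (hα1 : α < 1) (D : Finset S) (pol : S → A) {Jhat : S → ℝ}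
    (hJ : ∀ i ∈ D, Jhat i ∈ Set.Icc 0 (1 / (1 - α))) (i : S) :
    |rolloutNoise m α D pol Jhat i| ≤ 1 / (1 - α) := by
  have h0 : (0 : ℝ) ≤ 1 / (1 - α) := (one_div_pos.2 (sub_pos.2 hα1)).le
  unfold rolloutNoise
  split_ifs with hi
  · have h1 := hJ i hi
    have h2 := m.value_mem_Icc hcost hα0 hα1 pol i
    rw [abs_le]
    constructor <;> linarith [h1.1, h1.2, h2.1, h2.2]
  · simpa using h0

end Noise

/-! ### The error bound for least-squares policy iteration with lookahead -/

theorem theorem1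
    {S A : Type*} [Fintype S] [DecidableEq S] [MeasurableSpace S] [DiscreteMeasurableSpace S]
    [Finite A] [Nonempty A]
    (m : MDP S A) (hcost : m.CostsInUnitInterval)
    (α : ℝ) (hα0 : 0 < α) (hα1 : α < 1)
    (H : ℕ) (hH : 2 ≤ H)
    {d : ℕ} (Φ : Matrix S (Fin d) ℝ) (D : Finset S) (hrank : (featOn Φ D).rank = d)
    (γ : ℕ → ℝ) (hγ0 : ∀ k, 0 ≤ γ k)
    (hγ1 : Tendsto (fun n => ∑ k ∈ Finset.range n, γ k) atTop atTop)
    (hγ2 : Summable (fun k => γ k ^ 2))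
    {Ω : Type*} {mΩ : MeasurableSpace Ω} (P : Measure Ω) [IsProbabilityMeasure P]
    (F : Filtration ℕ mΩ)
    (V₀ : S → ℝ) (pol : ℕ → Ω → S → A) (Jhat : ℕ → Ω → S → ℝ)
    (θ : ℕ → Ω → Fin d → ℝ) (V : ℕ → Ω → S → ℝ)
    (hrun : ∀ ω, IsLSRun m α H Φ D γ V₀ (fun k => pol k ω) (fun k => Jhat k ω)
      (fun k => θ k ω) (fun k => V k ω))
    -- the policy of iteration `k` is determined by the history `F k`
    (hpol : ∀ k, @Measurable Ω (S → A) (F k) ⊤ (pol (k + 1)))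
    -- rollouts: the estimate at `i` is the discounted sum of the costs `c k i t` incurred along a
    -- simulated trajectory, and these costs lie in `[0, 1]` with probability one; beyond the
    -- unbiasedness `hmean` nothing is required of the way in which trajectories are simulated
    (c : ℕ → S → ℕ → Ω → ℝ)
    (hroll : ∀ k, ∀ i ∈ D, ∀ ω, Jhat (k + 1) ω i = ∑' t : ℕ, α ^ t * c k i t ω)
    (hc : ∀ k, ∀ i ∈ D, ∀ t, ∀ᵐ ω ∂P, c k i t ω ∈ Set.Icc (0 : ℝ) 1)
    -- the noise `w_k` is known at time `k + 1` and has conditional mean zero given `F k`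
    (hadapt : ∀ k i,
      Measurable[F (k + 1)] (fun ω => rolloutNoise m α D (pol (k + 1) ω) (Jhat (k + 1) ω) i))
    (hmean : ∀ k i,
      P[fun ω => rolloutNoise m α D (pol (k + 1) ω) (Jhat (k + 1) ω) i | F k] =ᵐ[P] 0) :
    ∀ᵐ ω ∂P,
      limsup (fun k => ((‖V k ω - m.optValue α‖ : ℝ) : EReal)) atTop ≤
        ((projError m α Φ D / (1 - α ^ (H - 1)) +
          α ^ (H - 1) * ((1 + α) * (projError m α Φ D + 1 / (1 - α))) /
            ((1 - α) * (1 - α ^ (H - 1))) : ℝ) : EReal) := by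
  have hγle : ∀ᶠ k in atTop, γ k ≤ 1 := by
    filter_upwards [hγ2.tendsto_atTop_zero.eventually_lt_const one_pos] with k hk
    exact (abs_le_one_iff_mul_self_le_one.2 (by nlinarith)).trans' (le_abs_self _)
  have hnoise : ∀ i, ∀ᵐ ω ∂P, ∃ l, Tendsto (fun n => ∑ k ∈ Finset.range n,
      γ k * rolloutNoise m α D (pol (k + 1) ω) (Jhat (k + 1) ω) i) atTop (nhds l) := by
    intro i
    refine ae_exists_tendsto_sum_martingaleDiff (F := F) (C := 1 / (1 - α)) (fun k => hadapt k i)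
      (fun k => ?_) (fun k => hmean k i) hγ2
    have hcosts : ∀ᵐ ω ∂P, ∀ j ∈ D, ∀ t, c k j t ω ∈ Set.Icc (0 : ℝ) 1 := by
      rw [ae_all_iff]
      intro j
      by_cases hj : j ∈ D
      · filter_upwards [ae_all_iff.2 (hc k j hj)] with ω hω _ using hω
      · exact ae_of_all _ fun ω hj' => absurd hj' hj
    filter_upwards [hcosts] with ω hω
    refine abs_rolloutNoise_le m hcost hα0.le hα1 D _ (fun j hj => ?_) i
    rw [hroll k j hj ω]
    exact tsum_discounted_mem_Icc hα0.le hα1 (hω j hj)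
  filter_upwards [ae_all_iff.2 hnoise] with ω hω
  exact ((hrun ω).isAsympBound_optValue hcost hα0 hα1 hH hrank hγ0 hγle hγ1 hω).limsup_le
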